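/- Throughout, everything takes place in a first-order structure $M$; "definable" means interpretable in $M$ with parameters, Morley rank is computed in $M$, and a definable group is *connected* if it has no proper definable subgroup of finite index. For $m\ge 0$ let $\Sigma_m=\mathbb Z_2\wr\mathrm{Sym}_m$ be the hyperoctahedral group, $E=\mathbb Z_2^m$ its base group, $e_1,\dots,e_m$ the standard generators of the $m$ factors of $E$, and $e=e_1e_2\cdots e_m$. **Proposition.** Let $V$ be a connected definable abelian group (written additively) of finite Morley rank $n$ without involutions, and suppose that $\Sigma=\Sigma_m$, with $m\ge n$, acts faithfully and definably on $V$ by automorphisms. Then $m=n$, and the following hold. For at least one of the two choices $d_i=e_i$ (for all $i$) or $d_i=e_ie$ (for all $i$), the subgroups $U_i=[V,d_i]=\langle d_iv-v : v\in V\rangle$ satisfy: (a) $V=\bigoplus_{i=1}^n U_i$, and every $U_i$ is definable, connected and of Morley rank $1$; (b) $d_i u=-u$ for every $u\in U_i$; (c) $d_i$ centralises every $U_j$ with $j\ne i$, and $C_V(d_i)=\bigoplus_{j\neq i}U_j$; (d) $\Sigma$ permutes the subgroups $U_1,\dots,U_n$ transitively. Moreover, (e) every connected definable $\Sigma$-invariant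 subgroup of $V$ equals $0$ or $V$; (f) $C_V(E)=0$, and therefore $C_V(\Sigma)=0$. -/

import Mathlib

open FirstOrder

/-! ### The hyperoctahedral group -/

/-- `Sym_m` acting on `Z_2 ^ m` by permuting the coordinates: `(s • a) i = a (s⁻¹ i)`. -/
def permuteCoordinates (m : ℕ) :
    Equiv.Perm (Fin m) →* MulAut (Fin m → Multiplicative (ZMod 2)) where
  toFun s :=
    { toFun := fun a i => a (s⁻¹ i)
      invFun := fun a i => a (s i)
      left_inv := fun a => by funext i; simp
      right_inv := fun a => by funext i; simp
      map_mul' := fun a b => rfl }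
  map_one' := rfl
  map_mul' s t := by ext a i; simp

/-- The hyperoctahedral group `Σ_m = Z_2 ≀ Sym_m = Z_2 ^ m ⋊ Sym_m`. -/
abbrev Hyperoctahedral (m : ℕ) : Type :=
  (Fin m → Multiplicative (ZMod 2)) ⋊[permuteCoordinates m] Equiv.Perm (Fin m)

namespace Hyperoctahedral

/-- The generator `e_i` of the `i`-th factor of the base group. -/
def e {m : ℕ} (i : Fin m) : Hyperoctahedral m :=
  SemidirectProduct.inl (Pi.mulSingle i (Multiplicative.ofAdd 1))

/-- The product `e = e_1 e_2 ⋯ e_m`. -/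
def eAll (m : ℕ) : Hyperoctahedral m :=
  SemidirectProduct.inl (∏ i : Fin m, Pi.mulSingle i (Multiplicative.ofAdd 1))

/-- The base group `E = Z_2 × ⋯ × Z_2`. -/
def base (m : ℕ) : Subgroup (Hyperoctahedral m) :=
  (SemidirectProduct.inl : (Fin m → Multiplicative (ZMod 2)) →* Hyperoctahedral m).range

end Hyperoctahedral

/-- `[V, g]`, the subgroup generated by all `g v - v`. -/
def commutatorWith {G V : Type*} [Group G] [AddCommGroup V] [DistribMulAction G V] (g : G) :
    AddSubgroup V :=
  AddSubgroup.closure (Set.range fun v : V => g • v - v)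

/-! ### Saturation and Morley rank -/

namespace FirstOrder.Language

universe u v w

/-- `N` is `ℵ₀`-saturated: every finitely satisfiable set of formulas in finitely many variables,
with parameters from a finite set, is realised in `N`. -/
def IsAlephZeroSaturated (L : Language.{u, v}) (N : Type w) [L.Structure N] : Prop :=
  ∀ A : Set N, A.Finite → ∀ (k : ℕ) (p : Set (L[[A]].Formula (Fin k))),
    (∀ q ⊆ p, q.Finite → ∃ x : Fin k → N, ∀ ψ ∈ q, ψ.Realize x) →
      ∃ x : Fin k → N, ∀ ψ ∈ p, ψ.Realize x

/-- `RankGE L E r S`: inside the structure `N`, the image of the set `S ⊆ N ^ k` modulo the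
equivalence relation `E` has rank at least `r`. Rank at least `0` means nonempty; rank at least
`r + 1` means that there are infinitely many pairwise disjoint definable (with parameters in `N`)
subsets of rank at least `r`. Definable subsets of the quotient are given by their preimages,
the `E`-invariant definable subsets. -/
def RankGE (L : Language.{u, v}) {N : Type w} [L.Structure N] {k : ℕ}
    (E : (Fin k → N) → (Fin k → N) → Prop) : ℕ → Set (Fin k → N) → Prop
  | 0, S => S.Nonempty
  | r + 1, S => ∃ T : ℕ → Set (Fin k → N),
      (∀ i, (Set.univ : Set N).Definable L (T i) ∧ T i ⊆ S ∧
        (∀ x ∈ T i, ∀ y ∈ S, E x y → y ∈ T i) ∧ RankGE L E r (T i)) ∧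
      ∀ i j, i ≠ j → Disjoint (T i) (T j)

end FirstOrder.Language

/-! ### Groups interpretable in a structure -/

universe uL vL uM uV

/-- A presentation of `V` as a quotient of a set `dom ⊆ M ^ arity` (the values of `proj` outside
`dom` are never used). -/
structure Coordinates (M : Type uM) (V : Type uV) where
  /-- length of the tuples -/
  arity : ℕ
  /-- the tuples that represent elements of `V` -/
  dom : Set (Fin arity → M)
  /-- the element represented by a tuple -/
  proj : (Fin arity → M) → V
  surj : ∀ v : V, ∃ x ∈ dom, proj x = v

namespace Coordinates

variable {M : Type uM} {V : Type uV} (L : FirstOrder.Language.{uL, vL}) [L.Structure M]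

/-- A subset of `V` is definable (in `M`, with parameters) when the set of tuples representing its
elements is. -/
def IsDefinable (c : Coordinates M V) (S : Set V) : Prop :=
  (Set.univ : Set M).Definable L {x : Fin c.arity → M | x ∈ c.dom ∧ c.proj x ∈ S}

/-- The same for a relation on `V` of arity `s`. -/
def IsDefinableRel (c : Coordinates M V) {s : ℕ} (R : Set (Fin s → V)) : Prop :=
  (Set.univ : Set M).Definable L {z : Fin s × Fin c.arity → M |
    (∀ i, (fun j => z (i, j)) ∈ c.dom) ∧ (fun i => c.proj fun j => z (i, j)) ∈ R}

/-- `V` is a group interpretable in `M`: its domain, equality and addition are definable. (If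
`proj` is injective on `dom`, then `V` is a group definable in `M`.) -/
structure IsInterpretableGroup [AddCommGroup V] (c : Coordinates M V) : Prop where
  dom_definable : c.IsDefinable L Set.univ
  eq_definable : c.IsDefinableRel L {p : Fin 2 → V | p 0 = p 1}
  add_definable : c.IsDefinableRel L {p : Fin 3 → V | p 0 + p 1 = p 2}

/-- The finite group `G` acts definably: the graph of every element of `G` is definable. -/
def IsDefinableAction (c : Coordinates M V) (G : Type*) [SMul G V] : Prop :=
  ∀ g : G, c.IsDefinableRel L {p : Fin 2 → V | g • p 0 = p 1}

/-- A connected subgroup: definable, with no proper definable subgroup of finite index. -/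
def IsConnected [AddCommGroup V] (c : Coordinates M V) (H : AddSubgroup V) : Prop :=
  c.IsDefinable L (H : Set V) ∧
    ∀ K : AddSubgroup V, K ≤ H → c.IsDefinable L (K : Set V) → K.relIndex H ≠ 0 → K = H

/-- `S ⊆ V` is definable and has Morley rank `r`: if the formulas `φ` and `ε`, with parameters in
`M`, define the tuples representing elements of `S`, and equality of the represented elements,
then the quotient of the set defined by `φ` by the relation defined by `ε`, taken in an
`ℵ₀`-saturated elementary extension `N` of `M`, has rank exactly `r`. -/
def HasMorleyRank (c : Coordinates M V) (S : Set V) (r : ℕ) : Prop :=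
  ∃ (φ : L.Formula (M ⊕ Fin c.arity)) (ε : L.Formula (M ⊕ (Fin c.arity ⊕ Fin c.arity))),
    (∀ x, φ.Realize (Sum.elim id x) ↔ x ∈ c.dom ∧ c.proj x ∈ S) ∧
    (∀ x y, ε.Realize (Sum.elim id (Sum.elim x y)) ↔
      x ∈ c.dom ∧ y ∈ c.dom ∧ c.proj x = c.proj y) ∧
    ∃ (N : Type (max uL vL uM)) (_ : L.Structure N) (f : M ↪ₑ[L] N),
      L.IsAlephZeroSaturated N ∧
      L.RankGE (fun x y => ε.Realize (Sum.elim f (Sum.elim x y))) r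
        {x | φ.Realize (Sum.elim f x)} ∧
      ¬ L.RankGE (fun x y => ε.Realize (Sum.elim f (Sum.elim x y))) (r + 1)
        {x | φ.Realize (Sum.elim f x)}

end Coordinates

/-! ### A calculus of definable relations -/

namespace Coordinates

variable {M : Type uM} {V : Type uV} {L : FirstOrder.Language.{uL, vL}} [L.Structure M]

/-! The proof diagonalises the base group `E` and counts weights.

Doubling is injective on `V`. Its image has the same rank as `V`, hence finite index, hence is `V`
by connectedness (`surjective_of_injective`). So 2 acts invertibly, and `V` is the direct sum of the
weight spaces of `E`, indexed by the subsets `s` of `Fin m`. Each is a definable homomorphic image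
of `V`, hence connected, hence zero or infinite. Adding an independent infinite summand raises the
rank by at least one (`hasRankGE_add_card`), so at most `n ≤ m` weights occur.

The set of occurring weights is stable under `Sym_m`, and by faithfulness it separates the points of
`E`. A layer of `k`-subsets with `1 < k < m - 1` has more than `m` members, while the weights `∅`
and `univ` alone do not separate points. What remains is exactly the layer of singletons, or that of
their complements with `m` even (`eq_image_singleton_or_compl`). So `m = n`, and no weight space can
have rank 2. The involutions `e i`, respectively `e i * eAll m`, act as -1 on one weight space and
trivially on the others.

For an invariant connected `W`, the subgroup `(1 - d i) W` lies in `W` and in the connected rank-one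
group `U i`, so it is `0` or `U i`. If every one vanishes, `W` is fixed by all `d i` and is zero;
otherwise transitivity puts every `U j` inside `W`.

Only lower bounds on ranks are ever constructed; the upper bounds all come from the rank of `V`. -/

theorem definable_univ_iff {α : Type*} {S : Set (α → M)} :
    (Set.univ : Set M).Definable L S ↔
      ∃ φ : L.Formula (M ⊕ α), ∀ x, φ.Realize (Sum.elim id x) ↔ x ∈ S := by
  rw [Set.definable_iff_exists_formula_sum]
  constructor
  · rintro ⟨φ, rfl⟩
    refine ⟨φ.relabel (Sum.map Subtype.val id), fun x => ?_⟩
    rw [FirstOrder.Language.Formula.realize_relabel]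
    refine iff_of_eq (congrArg φ.Realize ?_)
    funext a
    rcases a with a | a <;> rfl
  · rintro ⟨φ, hφ⟩
    refine ⟨φ.relabel (Sum.map (fun a => ⟨a, trivial⟩) id), ?_⟩
    ext x
    rw [← hφ x, Set.mem_ofPred_eq, FirstOrder.Language.Formula.realize_relabel]
    refine iff_of_eq (congrArg φ.Realize ?_)
    funext a
    rcases a with a | a <;> rfl

variable (L) in
/-- Definability of a relation on `V` whose places are indexed by an arbitrary type. -/
def IsDefinableOn (c : Coordinates M V) {ι : Type} (R : Set (ι → V)) : Prop :=
  (Set.univ : Set M).Definable L {z : ι × Fin c.arity → M |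
    (∀ i, (fun j => z (i, j)) ∈ c.dom) ∧ (fun i => c.proj fun j => z (i, j)) ∈ R}

variable {c : Coordinates M V}

theorem IsDefinableOn.inter {ι : Type} {R S : Set (ι → V)} (hR : c.IsDefinableOn L R)
    (hS : c.IsDefinableOn L S) : c.IsDefinableOn L (R ∩ S) := by
  unfold IsDefinableOn
  convert Set.Definable.inter hR hS using 1
  ext z
  simp only [Set.mem_inter_iff, Set.mem_ofPred_eq]
  tauto

theorem IsDefinableOn.exists {ι κ : Type} [Finite κ] {R : Set (ι ⊕ κ → V)}
    (hR : c.IsDefinableOn L R) :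
    c.IsDefinableOn L {p : ι → V | ∃ u : κ → V, Sum.elim p u ∈ R} := by
  have h := (Set.Definable.preimage_comp
    (Equiv.sumProdDistrib ι κ (Fin c.arity)) hR).exists_of_finite
  unfold IsDefinableOn
  convert h using 1
  ext z
  simp only [Set.mem_ofPred_eq, Set.mem_preimage]
  constructor
  · rintro ⟨hz, u, hu⟩
    -- Quantifying over elements of `V` becomes quantifying over representing tuples, since every
    -- element has one.
    choose w hw hwu using fun k => c.surj (u k)
    refine ⟨fun q => w q.1 q.2, ?_, ?_⟩
    · rintro (i | k)
      · exact hz i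
      · exact hw k
    · convert hu using 1
      funext q
      rcases q with i | k
      · rfl
      · exact hwu k
  · rintro ⟨w, hw, hR⟩
    refine ⟨fun i => hw (Sum.inl i), fun k => c.proj fun j => w (k, j), ?_⟩
    convert hR using 1
    funext q
    rcases q with i | k <;> rfl

theorem isDefinable_iff {S : Set V} :
    c.IsDefinable L S ↔ c.IsDefinableOn L {p : Fin 1 → V | p 0 ∈ S} := by
  constructor
  · intro h
    unfold IsDefinableOn IsDefinable at *
    convert Set.Definable.preimage_comp (fun j => ((0 : Fin 1), j)) h using 1
    ext z
    simp [Function.comp_def]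
  · intro h
    unfold IsDefinableOn IsDefinable at *
    convert Set.Definable.preimage_comp (fun q : Fin 1 × Fin c.arity => q.2) h using 1
    ext z
    simp [Function.comp_def]

theorem IsDefinable.inter {S T : Set V} (hS : c.IsDefinable L S)
    (hT : c.IsDefinable L T) : c.IsDefinable L (S ∩ T) :=
  isDefinable_iff.2 ((isDefinable_iff.1 hS).inter (isDefinable_iff.1 hT))

variable [AddCommGroup V]

namespace IsInterpretableGroup

variable (hV : c.IsInterpretableGroup L)
include hV

/-- Places of `κ` outside the range of `σ` must still carry tuples from `dom`; this is the finite
intersection `h2`. -/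
theorem reindex {ι κ : Type} [Finite κ] (σ : ι → κ) {R : Set (ι → V)}
    (hR : c.IsDefinableOn L R) : c.IsDefinableOn L {p : κ → V | p ∘ σ ∈ R} := by
  have h1 := Set.Definable.preimage_comp (Prod.map σ id) hR
  have h2 := Set.definable_iInter_of_finite (L := L) (fun k : κ =>
    Set.Definable.preimage_comp (fun j => (k, j)) hV.dom_definable)
  unfold IsDefinableOn
  convert h1.inter h2 using 1
  ext z
  simp only [Set.mem_ofPred_eq, Set.mem_inter_iff, Set.mem_preimage, Set.mem_iInter,
    Set.mem_univ, and_true]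
  constructor
  · rintro ⟨h, h'⟩
    exact ⟨⟨fun i => h (σ i), h'⟩, h⟩
  · rintro ⟨⟨_, h'⟩, h⟩
    exact ⟨h, h'⟩

theorem isDefinable_singleton (v : V) : c.IsDefinable L {v} := by
  obtain ⟨x, hx, rfl⟩ := c.surj v
  obtain ⟨φ, hφ⟩ := definable_univ_iff.1 hV.eq_definable
  refine definable_univ_iff.2 ⟨φ.relabel (Sum.elim Sum.inl fun q : Fin 2 × Fin c.arity =>
    if q.1 = 0 then Sum.inr q.2 else Sum.inl (x q.2)), fun y => ?_⟩
  rw [FirstOrder.Language.Formula.realize_relabel]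
  have := hφ (fun q => if q.1 = 0 then y q.2 else x q.2)
  rw [show (Sum.elim id y ∘ Sum.elim Sum.inl fun q : Fin 2 × Fin c.arity =>
    if q.1 = 0 then Sum.inr q.2 else Sum.inl (x q.2)) =
    Sum.elim id (fun q => if q.1 = 0 then y q.2 else x q.2) from ?_, this]
  · simp [Fin.forall_fin_two, hx]
  · funext q
    rcases q with a | q
    · rfl
    · simp only [Function.comp_apply, Sum.elim_inr]
      split_ifs <;> rfl

/-- The functions `V → V` whose graph is definable. -/
def definableFunctions : AddSubgroup (V → V) where
  carrier := {g | c.IsDefinableOn L {p : Fin 2 → V | g (p 0) = p 1}}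
  zero_mem' := by
    show c.IsDefinableOn L _
    have := hV.reindex (fun _ : Fin 1 => (1 : Fin 2))
      (isDefinable_iff.1 (hV.isDefinable_singleton 0))
    convert this using 1
    ext p
    simp [eq_comm]
  add_mem' := by
    intro g h hg hh
    have h1 := hV.reindex (κ := Fin 2 ⊕ Fin 2) ![Sum.inl 0, Sum.inr 0] hg
    have h2 := hV.reindex (κ := Fin 2 ⊕ Fin 2) ![Sum.inl 0, Sum.inr 1] hh
    have h3 := hV.reindex (κ := Fin 2 ⊕ Fin 2) ![Sum.inr 0, Sum.inr 1, Sum.inl 1]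
      (R := {p : Fin 3 → V | p 0 + p 1 = p 2}) hV.add_definable
    show c.IsDefinableOn L _
    convert ((h1.inter h2).inter h3).exists using 1
    ext p
    simp only [Set.mem_ofPred_eq, Set.mem_inter_iff]
    constructor
    · intro h'
      exact ⟨![g (p 0), h (p 0)], ⟨rfl, rfl⟩, h'⟩
    · rintro ⟨u, ⟨h1, h2⟩, h3⟩
      change g (p 0) = u 0 at h1
      change h (p 0) = u 1 at h2
      change u 0 + u 1 = p 1 at h3
      simp [h1, h2, h3]
  neg_mem' := by
    intro g hg
    have h1 := hV.reindex (κ := Fin 2 ⊕ Fin 2) ![Sum.inl 0, Sum.inr 0] hg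
    have h2 := hV.reindex (κ := Fin 2 ⊕ Fin 2) ![Sum.inr 0, Sum.inl 1, Sum.inr 1]
      (R := {p : Fin 3 → V | p 0 + p 1 = p 2}) hV.add_definable
    have h3 := hV.reindex (κ := Fin 2 ⊕ Fin 2) (fun _ : Fin 1 => Sum.inr 1)
      (isDefinable_iff.1 (hV.isDefinable_singleton 0))
    show c.IsDefinableOn L _
    convert ((h1.inter h2).inter h3).exists using 1
    ext p
    simp only [Set.mem_ofPred_eq, Set.mem_inter_iff]
    constructor
    · intro h'
      refine ⟨![g (p 0), 0], ⟨rfl, ?_⟩, rfl⟩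
      show g (p 0) + p 1 = 0
      simp [← h']
    · rintro ⟨u, ⟨h1, h2⟩, h3⟩
      change g (p 0) = u 0 at h1
      change u 0 + p 1 = u 1 at h2
      change u 1 = 0 at h3
      rw [h3, ← h1] at h2
      exact neg_eq_of_add_eq_zero_right h2

theorem mem_definableFunctions {g : V → V} : g ∈ hV.definableFunctions ↔
    c.IsDefinableOn L {p : Fin 2 → V | g (p 0) = p 1} := Iff.rfl

theorem const_mem (v : V) : (fun _ => v) ∈ hV.definableFunctions := by
  have := hV.reindex (fun _ : Fin 1 => (1 : Fin 2))
      (isDefinable_iff.1 (hV.isDefinable_singleton v))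
  rw [mem_definableFunctions]
  convert this using 1
  ext p
  simp [eq_comm]

theorem id_mem : (fun v => v) ∈ hV.definableFunctions := hV.eq_definable

theorem isDefinable_image {g : V → V} (hg : g ∈ hV.definableFunctions) {S : Set V}
    (hS : c.IsDefinable L S) : c.IsDefinable L (g '' S) := by
  have h1 := hV.reindex (κ := Fin 1 ⊕ Fin 1) ![Sum.inr 0, Sum.inl 0] hg
  have h2 := hV.reindex (κ := Fin 1 ⊕ Fin 1) (fun _ : Fin 1 => Sum.inr 0) (isDefinable_iff.1 hS)
  rw [isDefinable_iff]
  convert (h1.inter h2).exists using 1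
  ext p
  constructor
  · rintro ⟨v, hv, h⟩
    exact ⟨![v], h, hv⟩
  · rintro ⟨u, h1, h2⟩
    exact ⟨u 0, h2, h1⟩

theorem isDefinable_preimage {g : V → V} (hg : g ∈ hV.definableFunctions) {S : Set V}
    (hS : c.IsDefinable L S) : c.IsDefinable L (g ⁻¹' S) := by
  have h1 := hV.reindex (κ := Fin 1 ⊕ Fin 1) ![Sum.inl 0, Sum.inr 0] hg
  have h2 := hV.reindex (κ := Fin 1 ⊕ Fin 1) (fun _ : Fin 1 => Sum.inr 0) (isDefinable_iff.1 hS)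
  rw [isDefinable_iff]
  convert (h1.inter h2).exists using 1
  ext p
  constructor
  · intro h
    exact ⟨![g (p 0)], rfl, h⟩
  · rintro ⟨u, h1, h2⟩
    change g (p 0) = u 0 at h1
    change u 0 ∈ S at h2
    simpa [h1] using h2

theorem isDefinable_add {S T : Set V} (hS : c.IsDefinable L S) (hT : c.IsDefinable L T) :
    c.IsDefinable L {v | ∃ a ∈ S, ∃ b ∈ T, a + b = v} := by
  have h1 := hV.reindex (κ := Fin 1 ⊕ Fin 2) (fun _ : Fin 1 => Sum.inr 0) (isDefinable_iff.1 hS)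
  have h2 := hV.reindex (κ := Fin 1 ⊕ Fin 2) (fun _ : Fin 1 => Sum.inr 1) (isDefinable_iff.1 hT)
  have h3 := hV.reindex (κ := Fin 1 ⊕ Fin 2) ![Sum.inr 0, Sum.inr 1, Sum.inl 0]
      (R := {p : Fin 3 → V | p 0 + p 1 = p 2}) hV.add_definable
  rw [isDefinable_iff]
  convert ((h1.inter h2).inter h3).exists using 1
  ext p
  constructor
  · rintro ⟨a, ha, b, hb, h⟩
    exact ⟨![a, b], ⟨ha, hb⟩, h⟩
  · rintro ⟨u, ⟨h1, h2⟩, h3⟩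
    exact ⟨u 0, h1, u 1, h2, h3⟩

theorem isDefinable_sup {A B : AddSubgroup V} (hA : c.IsDefinable L (A : Set V))
    (hB : c.IsDefinable L (B : Set V)) : c.IsDefinable L ((A ⊔ B : AddSubgroup V) : Set V) := by
  convert hV.isDefinable_add hA hB using 1
  ext v
  simp [AddSubgroup.mem_sup]

/-! ### Connected subgroups -/

/-- The preimage in `H` of a subgroup of `g(H)` has the same index in `H` as that subgroup has in
`g(H)`. -/
theorem isConnected_map {H : AddSubgroup V} (hH : c.IsConnected L H) {g : V →+ V}
    (hg : (g : V → V) ∈ hV.definableFunctions) : c.IsConnected L (H.map g) := by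
  refine ⟨hV.isDefinable_image hg hH.1, fun K hK hKd hKi => le_antisymm hK ?_⟩
  rw [AddSubgroup.map_le_iff_le_comap]
  have h : H ⊓ K.comap g = H := by
    refine hH.2 _ inf_le_left (hH.1.inter (hV.isDefinable_preimage hg hKd)) ?_
    rw [AddSubgroup.inf_relIndex_left, AddSubgroup.relIndex_comap]
    exact hKi
  exact inf_eq_left.1 h

theorem infinite_of_isConnected {H : AddSubgroup V} (hH : c.IsConnected L H) (h : H ≠ ⊥) :
    (H : Set V).Infinite := by
  intro hfin
  apply h
  refine (hH.2 ⊥ bot_le (hV.isDefinable_singleton 0) ?_).symm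
  rw [AddSubgroup.relIndex_bot_left]
  have : Finite H := hfin
  exact Nat.card_pos.ne'

end IsInterpretableGroup

end Coordinates

/-! ### Ranks of definable sets -/

namespace FirstOrder.Language

/-- `R` plays the graph of an injection between quotients: a map on `V` has no direct meaning on
`N`, but the formula of its graph does. The sets `T i` are pushed forward along `R`; `hinv` keeps
the images `E`-invariant and `hinj` keeps them disjoint. -/
theorem RankGE.of_injection {L : Language} {N : Type*} [L.Structure N] {k : ℕ}
    {E R : (Fin k → N) → (Fin k → N) → Prop}
    (hR : (Set.univ : Set N).Definable L {z : Fin k ⊕ Fin k → N | R (z ∘ Sum.inl) (z ∘ Sum.inr)})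
    {r : ℕ} {S S' : Set (Fin k → N)} (hS' : (Set.univ : Set N).Definable L S')
    (htotal : ∀ x ∈ S, ∃ y ∈ S', R x y)
    (hinj : ∀ x ∈ S, ∀ x' ∈ S, ∀ y ∈ S', R x y → R x' y → E x x')
    (hinv : ∀ x ∈ S, ∀ y ∈ S', ∀ y' ∈ S', R x y → E y y' → R x y')
    (h : L.RankGE E r S) : L.RankGE E r S' := by
  induction r generalizing S S' with
  | zero =>
    obtain ⟨x, hx⟩ := h
    obtain ⟨y, hy, -⟩ := htotal x hx
    exact ⟨y, hy⟩
  | succ r ih =>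
    obtain ⟨T, hT, hdisj⟩ := h
    have hdef : ∀ i, (Set.univ : Set N).Definable L {y | y ∈ S' ∧ ∃ x ∈ T i, R x y} := by
      intro i
      have h1 := (hR.inter ((hT i).1.preimage_comp (Sum.inl : Fin k → Fin k ⊕ Fin k))).image_comp
        (Sum.inr : Fin k → Fin k ⊕ Fin k)
      convert hS'.inter h1 using 1
      ext y
      simp only [Set.mem_ofPred_eq, Set.mem_inter_iff, Set.mem_image, Set.mem_preimage]
      refine and_congr_right fun _ => ⟨?_, ?_⟩
      · rintro ⟨x, hx, hxy⟩
        exact ⟨Sum.elim x y, ⟨hxy, hx⟩, rfl⟩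
      · rintro ⟨z, ⟨h1, h2⟩, rfl⟩
        exact ⟨z ∘ Sum.inl, h2, h1⟩
    refine ⟨fun i => {y | y ∈ S' ∧ ∃ x ∈ T i, R x y}, fun i => ⟨hdef i, fun y hy => hy.1, ?_, ?_⟩,
      fun i j hij => ?_⟩
    · rintro y ⟨hy, x, hx, hxy⟩ y' hy' hyy'
      exact ⟨hy', x, hx, hinv x ((hT i).2.1 hx) y hy y' hy' hxy hyy'⟩
    · refine ih (hdef i) ?_ ?_ ?_ (hT i).2.2.2
      · intro x hx
        obtain ⟨y, hy, hxy⟩ := htotal x ((hT i).2.1 hx)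
        exact ⟨y, ⟨hy, x, hx, hxy⟩, hxy⟩
      · intro x hx x' hx' y hy
        exact hinj x ((hT i).2.1 hx) x' ((hT i).2.1 hx') y hy.1
      · intro x hx y hy y' hy'
        exact hinv x ((hT i).2.1 hx) y hy.1 y' hy'.1
    · rw [Set.disjoint_left]
      rintro y ⟨hy, x, hx, hxy⟩ ⟨-, x', hx', hxy'⟩
      have hx1 := (hT i).2.1 hx
      have hx2 := (hT j).2.1 hx'
      exact Set.disjoint_left.1 (hdisj i j hij)
        ((hT i).2.2.1 x hx x' hx2 (hinj x hx1 x' hx2 y hy hxy hxy')) hx'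

end FirstOrder.Language

/-! ### Transfer from `M` to the elementary extension `N` -/

namespace Coordinates

variable {M : Type uM} {V : Type uV} {L : FirstOrder.Language.{uL, vL}} [L.Structure M]
  {N : Type*} [L.Structure N]

theorem elim_comp_sumAssoc_symm {α β γ P : Type*} (u : α → P) (x : β → P) (y : γ → P) :
    Sum.elim (Sum.elim u x) y ∘ (Equiv.sumAssoc α β γ).symm = Sum.elim u (Sum.elim x y) := by
  funext q
  rcases q with q | q | q <;> rfl

/-- The transfer principle: finiteness of `α` allows the universal closure to be formed, and `f`
preserves its truth. -/
theorem realize_of_forall (f : M ↪ₑ[L] N) {α : Type*} [Finite α] (θ : L.Formula (M ⊕ α))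
    (h : ∀ x, θ.Realize (Sum.elim id x)) (y : α → N) : θ.Realize (Sum.elim f y) := by
  have h1 : (θ.iAlls α).Realize (id : M → M) :=
    FirstOrder.Language.Formula.realize_iAlls.2 fun x => h x
  rw [← f.map_formula] at h1
  exact FirstOrder.Language.Formula.realize_iAlls.1 h1 y

theorem definable_realize (f : M ↪ₑ[L] N) {α : Type*} (θ : L.Formula (M ⊕ α)) :
    (Set.univ : Set N).Definable L {y | θ.Realize (Sum.elim f y)} := by
  refine definable_univ_iff.2 ⟨θ.relabel (Sum.map f id), fun x => ?_⟩
  rw [FirstOrder.Language.Formula.realize_relabel, Set.mem_ofPred_eq]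
  refine iff_of_eq (congrArg θ.Realize ?_)
  funext a
  rcases a with a | a <;> rfl

variable (c : Coordinates M V) (ε : L.Formula (M ⊕ (Fin c.arity ⊕ Fin c.arity)))
  (f : M ↪ₑ[L] N)

/-- The formula `φ` defines the tuples representing elements of `S`. -/
def Defines (φ : L.Formula (M ⊕ Fin c.arity)) (S : Set V) : Prop :=
  ∀ x, φ.Realize (Sum.elim id x) ↔ x ∈ c.dom ∧ c.proj x ∈ S

/-- The formula `ε` defines equality of represented elements. -/
def DefinesEq : Prop :=
  ∀ x y, ε.Realize (Sum.elim id (Sum.elim x y)) ↔ x ∈ c.dom ∧ y ∈ c.dom ∧ c.proj x = c.proj y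

/-- The points in `N` of the set defined by `φ`, modulo `ε`, have rank at least `r`. -/
def FormulaRankGE (r : ℕ) (φ : L.Formula (M ⊕ Fin c.arity)) : Prop :=
  L.RankGE (fun x y => ε.Realize (Sum.elim f (Sum.elim x y))) r {x | φ.Realize (Sum.elim f x)}

/-- `S` is definable and has rank at least `r` in the elementary extension `N`. -/
def HasRankGE (r : ℕ) (S : Set V) : Prop :=
  ∃ φ, c.Defines φ S ∧ c.FormulaRankGE ε f r φ

variable {c ε f}

theorem IsDefinable.exists_defines {S : Set V} (hS : c.IsDefinable L S) :
    ∃ φ : L.Formula (M ⊕ Fin c.arity), c.Defines φ S :=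
  definable_univ_iff.1 hS

theorem realize_imp_of_subset {φ ψ : L.Formula (M ⊕ Fin c.arity)} {S T : Set V}
    (hφ : c.Defines φ S) (hψ : c.Defines ψ T) (h : S ⊆ T) {x : Fin c.arity → N}
    (hx : φ.Realize (Sum.elim f x)) : ψ.Realize (Sum.elim f x) := by
  have := realize_of_forall f (φ.imp ψ) (fun x => by
    rw [FirstOrder.Language.Formula.realize_imp, hφ, hψ]
    exact fun hx => ⟨hx.1, h hx.2⟩) x
  exact FirstOrder.Language.Formula.realize_imp.1 this hx

/-- Formulas defining the same set in `M` also agree in `N`, so the rank does not depend on the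
chosen formula. -/
theorem HasRankGE.formulaRankGE {r : ℕ} {S : Set V} (h : c.HasRankGE ε f r S)
    {φ : L.Formula (M ⊕ Fin c.arity)} (hφ : c.Defines φ S) : c.FormulaRankGE ε f r φ := by
  obtain ⟨ψ, hψ, h⟩ := h
  have : {x | φ.Realize (Sum.elim f x)} = {x | ψ.Realize (Sum.elim f x)} :=
    Set.ext fun x => ⟨realize_imp_of_subset hφ hψ subset_rfl,
      realize_imp_of_subset hψ hφ subset_rfl⟩
  rwa [FormulaRankGE, this]

theorem hasRankGE_zero {S : Set V} (hS : c.IsDefinable L S) (h : S.Nonempty) :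
    c.HasRankGE ε f 0 S := by
  obtain ⟨φ, hφ⟩ := hS.exists_defines
  obtain ⟨v, hv⟩ := h
  obtain ⟨x, hx, rfl⟩ := c.surj v
  refine ⟨φ, hφ, f ∘ x, ?_⟩
  have := (hφ x).2 ⟨hx, hv⟩
  rw [← f.map_formula] at this
  rw [Set.mem_ofPred_eq]
  convert this using 1
  funext a
  rcases a with a | a <;> rfl

theorem hasRankGE_succ (hε : c.DefinesEq ε) {r : ℕ} {S : Set V} (hS : c.IsDefinable L S)
    (T : ℕ → Set V) (hT : ∀ i, T i ⊆ S) (hr : ∀ i, c.HasRankGE ε f r (T i))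
    (hdisj : ∀ i j, i ≠ j → Disjoint (T i) (T j)) : c.HasRankGE ε f (r + 1) S := by
  obtain ⟨φ, hφ⟩ := hS.exists_defines
  choose ψ hψ hψr using hr
  refine ⟨φ, hφ, fun i => {x | (ψ i).Realize (Sum.elim f x)}, fun i =>
    ⟨definable_realize f _, fun x => realize_imp_of_subset (hψ i) hφ (hT i), ?_, hψr i⟩, ?_⟩
  · intro x hx y _ hxy
    have := realize_of_forall f (α := Fin c.arity ⊕ Fin c.arity)
      (((ψ i).relabel (Sum.map id Sum.inl)).imp
        (ε.imp ((ψ i).relabel (Sum.map id Sum.inr)))) (fun z => by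
          obtain ⟨x, y, rfl⟩ : ∃ x y, z = Sum.elim x y := ⟨_, _, (Sum.elim_comp_inl_inr z).symm⟩
          simp only [FirstOrder.Language.Formula.realize_imp,
            FirstOrder.Language.Formula.realize_relabel, Sum.elim_comp_map, Sum.elim_comp_inl,
            Sum.elim_comp_inr, Function.comp_id]
          rw [hψ, hψ, hε]
          rintro ⟨-, h⟩ ⟨-, hy, h'⟩
          exact ⟨hy, h' ▸ h⟩) (Sum.elim x y)
    simp only [FirstOrder.Language.Formula.realize_imp,
            FirstOrder.Language.Formula.realize_relabel, Sum.elim_comp_map, Sum.elim_comp_inl,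
            Sum.elim_comp_inr, Function.comp_id] at this
    exact this hx hxy
  · intro i j hij
    rw [Set.disjoint_left]
    intro x hx hx'
    have := realize_of_forall f ((ψ i).imp (ψ j).not) (fun x => by
      rw [FirstOrder.Language.Formula.realize_imp, FirstOrder.Language.Formula.realize_not,
        hψ, hψ]
      exact fun h h' => Set.disjoint_left.1 (hdisj i j hij) h.2 h'.2) x
    rw [FirstOrder.Language.Formula.realize_imp, FirstOrder.Language.Formula.realize_not] at this
    exact this hx hx'

variable [AddCommGroup V]

/-- Totality, injectivity and compatibility with `ε` of the graph `ρ` of `g` are first-order, so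
they pass to `N`, where `RankGE.of_injection` applies. -/
theorem IsInterpretableGroup.hasRankGE_of_injOn (hV : c.IsInterpretableGroup L)
    (hε : c.DefinesEq ε) {g : V → V} (hg : g ∈ hV.definableFunctions) {S S' : Set V}
    (hS' : c.IsDefinable L S') (hgS : Set.MapsTo g S S') (hinj : Set.InjOn g S) {r : ℕ}
    (h : c.HasRankGE ε f r S) : c.HasRankGE ε f r S' := by
  obtain ⟨φ, hφ, h⟩ := h
  obtain ⟨ψ, hψ⟩ := hS'.exists_defines
  obtain ⟨ρ, hρ⟩ : ∃ ρ : L.Formula (M ⊕ (Fin c.arity ⊕ Fin c.arity)), ∀ x y,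
      ρ.Realize (Sum.elim id (Sum.elim x y)) ↔
        x ∈ c.dom ∧ y ∈ c.dom ∧ g (c.proj x) = c.proj y := by
    obtain ⟨ρ, hρ⟩ := definable_univ_iff.1 hg
    refine ⟨ρ.relabel (Sum.map id fun q => if q.1 = 0 then Sum.inl q.2 else Sum.inr q.2),
      fun x y => ?_⟩
    rw [FirstOrder.Language.Formula.realize_relabel, Sum.elim_comp_map, Function.comp_id, hρ]
    simp [Fin.forall_fin_two, and_assoc]
  refine ⟨ψ, hψ, FirstOrder.Language.RankGE.of_injection
    (R := fun x y => ρ.Realize (Sum.elim f (Sum.elim x y))) ?_ (definable_realize f ψ)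
    ?_ ?_ ?_ h⟩
  · convert definable_realize f ρ using 1
    ext z
    rw [Set.mem_ofPred_eq, Sum.elim_comp_inl_inr, Set.mem_ofPred_eq]
  · intro x hx
    have := realize_of_forall f
      (φ.imp (((ψ.relabel (Sum.map id Sum.inr) ⊓ ρ).relabel
        (Equiv.sumAssoc M (Fin c.arity) (Fin c.arity)).symm).iExs (Fin c.arity))) (fun x => by
          rw [FirstOrder.Language.Formula.realize_imp, hφ,
            FirstOrder.Language.Formula.realize_iExs]
          rintro ⟨hx, hxS⟩
          obtain ⟨y, hy, hxy⟩ := c.surj (g (c.proj x))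
          refine ⟨y, ?_⟩
          rw [FirstOrder.Language.Formula.realize_relabel, elim_comp_sumAssoc_symm,
            FirstOrder.Language.Formula.realize_inf,
            FirstOrder.Language.Formula.realize_relabel, Sum.elim_comp_map, Sum.elim_comp_inr,
            Function.comp_id, hψ, hρ]
          exact ⟨⟨hy, hxy ▸ hgS hxS⟩, hx, hy, hxy.symm⟩) x
    rw [FirstOrder.Language.Formula.realize_imp,
      FirstOrder.Language.Formula.realize_iExs] at this
    obtain ⟨y, hy⟩ := this hx
    rw [FirstOrder.Language.Formula.realize_relabel, elim_comp_sumAssoc_symm,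
      FirstOrder.Language.Formula.realize_inf,
      FirstOrder.Language.Formula.realize_relabel, Sum.elim_comp_map, Sum.elim_comp_inr,
      Function.comp_id] at hy
    exact ⟨y, hy⟩
  · intro x hx x' hx' y _ hxy hx'y
    have := realize_of_forall f (α := Fin c.arity ⊕ (Fin c.arity ⊕ Fin c.arity))
      ((φ.relabel (Sum.map id Sum.inl)).imp
        ((φ.relabel (Sum.map id (Sum.inr ∘ Sum.inl))).imp
        ((ρ.relabel (Sum.map id (Sum.elim Sum.inl (Sum.inr ∘ Sum.inr)))).imp
        ((ρ.relabel (Sum.map id Sum.inr)).imp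
        (ε.relabel (Sum.map id (Sum.elim Sum.inl (Sum.inr ∘ Sum.inl))))))))
      (fun z => by
        obtain ⟨x, x', y, rfl⟩ : ∃ x x' y, z = Sum.elim x (Sum.elim x' y) :=
          ⟨z ∘ Sum.inl, z ∘ Sum.inr ∘ Sum.inl, z ∘ Sum.inr ∘ Sum.inr, by
            funext q; rcases q with q | q | q <;> rfl⟩
        simp only [FirstOrder.Language.Formula.realize_imp,
          FirstOrder.Language.Formula.realize_relabel, Sum.elim_comp_map, Sum.elim_comp_inl,
          Sum.elim_comp_inr, Function.comp_id, Sum.comp_elim, ← Function.comp_assoc]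
        rw [hφ, hφ, hρ, hρ, hε]
        rintro ⟨hx, hxS⟩ ⟨hx', hxS'⟩ ⟨-, -, h1⟩ ⟨-, -, h2⟩
        exact ⟨hx, hx', hinj hxS hxS' (h1.trans h2.symm)⟩) (Sum.elim x (Sum.elim x' y))
    simp only [FirstOrder.Language.Formula.realize_imp,
      FirstOrder.Language.Formula.realize_relabel, Sum.elim_comp_map, Sum.elim_comp_inl,
      Sum.elim_comp_inr, Function.comp_id, Sum.comp_elim, ← Function.comp_assoc] at this
    exact this hx hx' hxy hx'y
  · intro x _ y _ y' _ hxy hyy'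
    have := realize_of_forall f (α := Fin c.arity ⊕ (Fin c.arity ⊕ Fin c.arity))
      ((ρ.relabel (Sum.map id (Sum.elim Sum.inl (Sum.inr ∘ Sum.inl)))).imp
        ((ε.relabel (Sum.map id Sum.inr)).imp
        (ρ.relabel (Sum.map id (Sum.elim Sum.inl (Sum.inr ∘ Sum.inr))))))
      (fun z => by
        obtain ⟨x, x', y, rfl⟩ : ∃ x x' y, z = Sum.elim x (Sum.elim x' y) :=
          ⟨z ∘ Sum.inl, z ∘ Sum.inr ∘ Sum.inl, z ∘ Sum.inr ∘ Sum.inr, by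
            funext q; rcases q with q | q | q <;> rfl⟩
        simp only [FirstOrder.Language.Formula.realize_imp,
          FirstOrder.Language.Formula.realize_relabel, Sum.elim_comp_map, Sum.elim_comp_inl,
          Sum.elim_comp_inr, Function.comp_id, Sum.comp_elim, ← Function.comp_assoc]
        rw [hρ, hρ, hε]
        rintro ⟨hx, -, h1⟩ ⟨-, hy, h2⟩
        exact ⟨hx, hy, h1.trans h2⟩) (Sum.elim x (Sum.elim y y'))
    simp only [FirstOrder.Language.Formula.realize_imp,
      FirstOrder.Language.Formula.realize_relabel, Sum.elim_comp_map, Sum.elim_comp_inl,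
      Sum.elim_comp_inr, Function.comp_id, Sum.comp_elim, ← Function.comp_assoc] at this
    exact this hxy hyy'

end Coordinates

/-! ### Ranks of definable subgroups -/

namespace Coordinates.IsInterpretableGroup

variable {M : Type uM} {V : Type uV} {L : FirstOrder.Language.{uL, vL}} [L.Structure M]
  {N : Type*} [L.Structure N] {c : Coordinates M V}
  {ε : L.Formula (M ⊕ (Fin c.arity ⊕ Fin c.arity))} {f : M ↪ₑ[L] N} [AddCommGroup V]
  (hV : c.IsInterpretableGroup L) (hε : c.DefinesEq ε)

include hV hε

theorem hasRankGE_mono {S T : Set V} (hT : c.IsDefinable L T) (h : S ⊆ T) {r : ℕ}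
    (hS : c.HasRankGE ε f r S) : c.HasRankGE ε f r T :=
  hV.hasRankGE_of_injOn hε hV.id_mem hT h (fun _ _ _ _ h => h) hS

theorem hasRankGE_translate (a : V) {S : Set V} (hS : c.IsDefinable L S) {r : ℕ}
    (hr : c.HasRankGE ε f r S) : c.HasRankGE ε f r ((fun v => a + v) '' S) := by
  have h := hV.definableFunctions.add_mem (hV.const_mem a) hV.id_mem
  exact hV.hasRankGE_of_injOn hε h (hV.isDefinable_image h hS) (Set.mapsTo_image _ _)
    (add_right_injective a).injOn hr

theorem hasRankGE_one {S : Set V} (hS : c.IsDefinable L S) (h : S.Infinite) :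
    c.HasRankGE ε f 1 S := by
  refine hasRankGE_succ hε hS (fun i => {(h.natEmbedding S i : V)})
    (fun i => Set.singleton_subset_iff.2 (h.natEmbedding S i).2)
    (fun i => hasRankGE_zero (hV.isDefinable_singleton _) (Set.singleton_nonempty _))
    fun i j hij => Set.disjoint_singleton.2 fun h' => hij ?_
  exact (h.natEmbedding S).injective (Subtype.ext h')

/-- Infinitely many cosets of `K` are disjoint translates of the same rank inside `H`. -/
theorem hasRankGE_succ_of_relIndex_eq_zero {K H : AddSubgroup V} (hKH : K ≤ H)
    (hK : c.IsDefinable L (K : Set V)) (hH : c.IsDefinable L (H : Set V))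
    (hi : K.relIndex H = 0) {r : ℕ} (hr : c.HasRankGE ε f r (K : Set V)) :
    c.HasRankGE ε f (r + 1) (H : Set V) := by
  have hinf : Infinite (H ⧸ K.addSubgroupOf H) :=
    AddSubgroup.index_eq_zero_iff_infinite.1 hi
  let a : ℕ ↪ (H ⧸ K.addSubgroupOf H) := Infinite.natEmbedding _
  refine hasRankGE_succ hε hH (fun i => (fun v => ((a i).out : V) + v) '' (K : Set V)) ?_
    (fun i => hV.hasRankGE_translate hε _ hK hr) ?_
  · rintro i _ ⟨k, hk, rfl⟩
    exact H.add_mem (a i).out.2 (hKH hk)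
  · intro i j hij
    rw [Set.disjoint_left]
    rintro _ ⟨k, hk, rfl⟩ ⟨k', hk', h⟩
    apply hij
    apply a.injective
    rw [← QuotientAddGroup.out_eq' (a i), ← QuotientAddGroup.out_eq' (a j),
      QuotientAddGroup.eq, AddSubgroup.mem_addSubgroupOf]
    have h : ((a j).out : V) + k' = (a i).out + k := h
    have : -((a i).out : V) + (a j).out = k - k' := by
      rw [neg_add_eq_iff_eq_add, ← add_sub_assoc, ← h, add_sub_cancel_right]
    rw [AddSubgroup.coe_add, AddSubgroup.coe_neg, this]
    exact K.sub_mem hk hk'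

theorem hasRankGE_succ_sup {A B : AddSubgroup V} (hA : c.IsDefinable L (A : Set V))
    (hB : c.IsDefinable L (B : Set V)) (hinf : (A : Set V).Infinite) (hAB : Disjoint A B) {r : ℕ}
    (hr : c.HasRankGE ε f r (B : Set V)) :
    c.HasRankGE ε f (r + 1) ((A ⊔ B : AddSubgroup V) : Set V) := by
  refine hV.hasRankGE_succ_of_relIndex_eq_zero hε le_sup_right hB (hV.isDefinable_sup hA hB) ?_ hr
  have : Infinite A := hinf.to_subtype
  rw [AddSubgroup.relIndex_sup_right, ← AddSubgroup.inf_relIndex_right, inf_comm, hAB.eq_bot,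
    AddSubgroup.relIndex_bot_left, Nat.card_eq_zero_of_infinite]

/-- One summand `U i₀` is credited with rank `r`, every other with rank 1. Taking `r = 1` bounds the
number of weights, and `r = 2` bounds the rank of each weight space. -/
theorem hasRankGE_add_card {ι : Type*} [DecidableEq ι] {U : ι → AddSubgroup V}
    (hind : iSupIndep U)
    (hU : ∀ i, c.IsDefinable L (U i : Set V)) {i₀ : ι} {r : ℕ}
    (hr : c.HasRankGE ε f r (U i₀ : Set V)) (F : Finset ι) (hF : i₀ ∉ F)
    (hinf : ∀ i ∈ F, (U i : Set V).Infinite) :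
    c.HasRankGE ε f (r + F.card) ((U i₀ ⊔ F.sup U : AddSubgroup V) : Set V) ∧
      c.IsDefinable L ((U i₀ ⊔ F.sup U : AddSubgroup V) : Set V) := by
  induction F using Finset.induction_on with
  | empty => simpa using ⟨hr, hU i₀⟩
  | insert i F hi ih =>
    obtain ⟨h1, h2⟩ := ih (fun h => hF (Finset.mem_insert_of_mem h))
      fun j hj => hinf j (Finset.mem_insert_of_mem hj)
    have hi₀ : i₀ ≠ i := fun h => hF (h ▸ Finset.mem_insert_self _ _)
    rw [Finset.sup_insert, sup_left_comm, Finset.card_insert_of_notMem hi, ← add_assoc]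
    refine ⟨hV.hasRankGE_succ_sup hε (hU i) h2 (hinf i (Finset.mem_insert_self _ _)) ?_ h1,
      hV.isDefinable_sup (hU i) h2⟩
    refine (hind i).mono_right (sup_le (le_iSup₂_of_le i₀ hi₀ le_rfl) ?_)
    exact Finset.sup_le fun j hj => le_iSup₂_of_le j (fun h => hi (h ▸ hj)) le_rfl

theorem surjective_of_injective {n : ℕ} (hconn : c.IsConnected L (⊤ : AddSubgroup V))
    (hn : c.HasRankGE ε f n (Set.univ : Set V)) (hn' : ¬ c.HasRankGE ε f (n + 1) (Set.univ : Set V))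
    {g : V →+ V} (hg : (g : V → V) ∈ hV.definableFunctions) (hinj : Function.Injective g) :
    Function.Surjective g := by
  have hd : c.IsDefinable L (g.range : Set V) := by
    have := hV.isDefinable_image hg hconn.1
    rwa [AddSubgroup.coe_top, Set.image_univ, ← AddMonoidHom.coe_range] at this
  rw [← AddMonoidHom.range_eq_top]
  refine hconn.2 _ le_top hd fun hi => hn' ?_
  have := hV.hasRankGE_succ_of_relIndex_eq_zero hε (f := f) le_top hd hconn.1 hi
    (hV.hasRankGE_of_injOn hε hg hd (fun v _ => ⟨v, rfl⟩) hinj.injOn hn)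
  rwa [AddSubgroup.coe_top] at this

end Coordinates.IsInterpretableGroup

/-! ### Weights of the base group -/

theorem Nat.le_choose_of_pos_of_lt {m k : ℕ} (hk : 0 < k) (hkm : k < m) : m ≤ m.choose k := by
  induction m generalizing k with
  | zero => omega
  | succ m ih =>
    obtain ⟨k, rfl⟩ : ∃ l, k = l + 1 := ⟨k - 1, by omega⟩
    rw [Nat.choose_succ_succ]
    rcases Nat.eq_or_lt_of_le (Nat.lt_succ_iff.1 hkm) with h | h
    · subst h
      simp
    · have h1 := ih (k := k + 1) (by omega) h
      have h2 := Nat.choose_pos (n := m) (k := k) (by omega)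
      rw [Nat.succ_eq_add_one]
      omega

/-- Both summands in Pascal's rule are at least `m - 1`, and `m` is at least 4. -/
theorem Nat.lt_choose_of_one_lt {m k : ℕ} (hk : 1 < k) (hkm : k + 1 < m) : m < m.choose k := by
  obtain ⟨m, rfl⟩ : ∃ l, m = l + 1 := ⟨m - 1, by omega⟩
  obtain ⟨k, rfl⟩ : ∃ l, k = l + 1 := ⟨k - 1, by omega⟩
  rw [Nat.choose_succ_succ]
  have h1 := Nat.le_choose_of_pos_of_lt (m := m) (k := k) (by omega) (by omega)
  have h2 := Nat.le_choose_of_pos_of_lt (m := m) (k := k + 1) (by omega) (by omega)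
  rw [Nat.succ_eq_add_one]
  omega

theorem Finset.exists_perm_map_eq {α : Type*} [Fintype α] [DecidableEq α] {s t : Finset α}
    (h : s.card = t.card) : ∃ σ : Equiv.Perm α, s.map σ.toEmbedding = t := by
  let e : {x // x ∈ s} ≃ {x // x ∈ t} := s.equivOfCardEq h
  refine ⟨e.extendSubtype, Finset.eq_of_subset_of_card_le ?_ (by simp [h])⟩
  intro x hx
  obtain ⟨y, hy, rfl⟩ := Finset.mem_map.1 hx
  exact e.extendSubtype_mem y hy

namespace Hyperoctahedral

variable {m : ℕ}

/-- The nontrivial character of the group of order two. -/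
def sign : Multiplicative (ZMod 2) →* ℤ where
  toFun x := if x = 1 then 1 else -1
  map_one' := rfl
  map_mul' := by decide

theorem sign_ofAdd_one : sign (Multiplicative.ofAdd 1) = -1 := rfl

theorem sign_eq_neg_one {x : Multiplicative (ZMod 2)} (h : x ≠ 1) : sign x = -1 := if_neg h

/-- The character of the base group that is nontrivial exactly on the `e i` with `i ∈ s`. -/
def weight (s : Finset (Fin m)) : (Fin m → Multiplicative (ZMod 2)) →* ℤ :=
  ∏ i ∈ s, sign.comp (Pi.evalMonoidHom _ i)

theorem weight_apply (s : Finset (Fin m)) (a : Fin m → Multiplicative (ZMod 2)) :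
    weight s a = ∏ i ∈ s, sign (a i) := by
  simp [weight, MonoidHom.finsetProd_apply]

theorem mul_self_eq_one (a : Fin m → Multiplicative (ZMod 2)) : a * a = 1 := by
  funext i
  exact (by decide : ∀ x : Multiplicative (ZMod 2), x * x = 1) (a i)

theorem weight_mul_self (s : Finset (Fin m)) (a : Fin m → Multiplicative (ZMod 2)) :
    weight s a * weight s a = 1 := by
  rw [← map_mul, mul_self_eq_one, map_one]

theorem weight_mulSingle (s : Finset (Fin m)) (i : Fin m) :
    weight s (Pi.mulSingle i (Multiplicative.ofAdd 1)) = if i ∈ s then -1 else 1 := by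
  rw [weight_apply]
  split_ifs with h
  · rw [Finset.prod_eq_single_of_mem i h, Pi.mulSingle_eq_same, sign_ofAdd_one]
    intro j _ hj
    rw [Pi.mulSingle_eq_of_ne hj, map_one]
  · refine Finset.prod_eq_one fun j hj => ?_
    rw [Pi.mulSingle_eq_of_ne (fun h' : j = i => h (h' ▸ hj)), map_one]

theorem weight_prod_mulSingle (s : Finset (Fin m)) :
    weight s (∏ i : Fin m, Pi.mulSingle i (Multiplicative.ofAdd 1)) = (-1) ^ s.card := by
  rw [map_prod]
  simp only [weight_mulSingle]
  rw [Finset.prod_ite_mem, Finset.univ_inter, Finset.prod_const]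

/-- Column orthogonality of characters: the sum over subsets expands the product of the `1 + sign (a
i)`. -/
theorem sum_weight (a : Fin m → Multiplicative (ZMod 2)) :
    ∑ s, weight s a = if a = 1 then 2 ^ m else 0 := by
  simp only [weight_apply]
  rw [← Finset.powerset_univ, ← Finset.prod_one_add]
  split_ifs with h
  · subst h
    simp
  · obtain ⟨i, hi⟩ := Function.ne_iff.1 h
    exact Finset.prod_eq_zero (Finset.mem_univ i) (by rw [sign_eq_neg_one hi]; norm_num)

theorem weight_map (s : Finset (Fin m)) (σ : Equiv.Perm (Fin m))
    (a : Fin m → Multiplicative (ZMod 2)) :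
    weight (s.map σ.toEmbedding) a = weight s (permuteCoordinates m σ⁻¹ a) := by
  rw [weight_apply, weight_apply, Finset.prod_map]
  rfl

theorem conj_e (g : Hyperoctahedral m) (i : Fin m) : g * e i = e (g.right i) * g := by
  ext j
  · simp only [e, SemidirectProduct.mul_left, SemidirectProduct.left_inl,
      SemidirectProduct.right_inl, map_one, MulAut.one_apply, Pi.mul_apply]
    rw [mul_comm]
    congr 1
    congr 1
    show (Pi.mulSingle i _ : Fin m → Multiplicative (ZMod 2)) (g.right⁻¹ j) = _
    by_cases hj : j = g.right i
    · subst hj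
      simp
    · rw [Pi.mulSingle_eq_of_ne hj, Pi.mulSingle_eq_of_ne]
      rintro rfl
      simp at hj
  · simp [e]

theorem conj_eAll (g : Hyperoctahedral m) : g * eAll m = eAll m * g := by
  have hall : (∏ i : Fin m, Pi.mulSingle i (Multiplicative.ofAdd 1) :
      Fin m → Multiplicative (ZMod 2)) = fun _ => Multiplicative.ofAdd 1 :=
    Finset.univ_prod_mulSingle _
  ext j
  · simp only [eAll, hall, SemidirectProduct.mul_left, SemidirectProduct.left_inl,
      SemidirectProduct.right_inl, map_one, MulAut.one_apply, Pi.mul_apply]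
    rw [mul_comm]
    rfl
  · simp [eAll]

theorem eq_image_singleton_or_compl {X : Finset (Finset (Fin m))}
    (hX : ∀ s ∈ X, ∀ σ : Equiv.Perm (Fin m), s.map σ.toEmbedding ∈ X) (hcard : X.card ≤ m)
    (hfaith : ∀ a, (∀ s ∈ X, weight s a = 1) → a = 1) :
    X.card = m ∧ (X = Finset.univ.image (fun i => {i}) ∨
      Even m ∧ X = Finset.univ.image (fun i => {i}ᶜ)) := by
  suffices h : ∃ k, (k = 1 ∨ k + 1 = m ∧ 0 < k) ∧ X = Finset.powersetCard k Finset.univ ∨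
      m = 0 by
    obtain ⟨k, ⟨hk, rfl⟩ | rfl⟩ := h
    swap
    · have : X = ∅ := Finset.card_eq_zero.1 (by omega)
      subst this
      simp
    rw [Finset.card_powersetCard, Finset.card_univ, Fintype.card_fin]
    rcases hk with rfl | ⟨hk, hk0⟩
    · refine ⟨by simp, Or.inl ?_⟩
      ext s
      simp [Finset.card_eq_one, eq_comm]
    · have himg : Finset.powersetCard k Finset.univ =
          Finset.univ.image (fun i : Fin m => ({i}ᶜ : Finset (Fin m))) := by
        ext s
        rw [Finset.mem_powersetCard_univ, Finset.mem_image]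
        simp only [Finset.mem_univ, true_and]
        rw [show s.card = k ↔ sᶜ.card = 1 by
          have := Finset.card_le_univ s
          rw [Fintype.card_fin] at this
          rw [Finset.card_compl, Fintype.card_fin]
          omega,
          Finset.card_eq_one]
        exact exists_congr fun i => by rw [eq_comm, compl_eq_comm, eq_comm, eq_comm]
      refine ⟨by rw [← hk, Nat.choose_succ_self_right], Or.inr ⟨?_, himg⟩⟩
      -- For odd `m` all weights in `X` have even size, so the product of all generators would lie
      -- in the kernel.
      by_contra hm
      have hke : Even k := by
        rw [← hk] at hm
        simpa [Nat.even_add_one] using hm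
      have := hfaith (∏ i : Fin m, Pi.mulSingle i (Multiplicative.ofAdd 1)) fun s hs => by
        rw [weight_prod_mulSingle, (Finset.mem_powersetCard.1 hs).2, hke.neg_one_pow]
      rw [Finset.univ_prod_mulSingle (fun _ : Fin m => Multiplicative.ofAdd (1 : ZMod 2))] at this
      have := congrFun this ⟨0, by omega⟩
      exact absurd this (by rw [Pi.one_apply]; decide)
  by_cases hm : m = 0
  · exact ⟨0, Or.inr hm⟩
  -- Otherwise `X` contains at most `∅` and `univ`, and only `∅` when `m = 1`. The kernel then
  -- contains the product of two generators, or the single generator when `m = 1`.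
  obtain ⟨s, hs, hs0, hs1⟩ : ∃ s ∈ X, 0 < s.card ∧ (s.card = 1 ∨ s.card < m) := by
    by_contra! hcon
    by_cases hm1 : m = 1
    · have h0 : (0 : ℕ) < m := by omega
      have := hfaith (Pi.mulSingle ⟨0, h0⟩ (Multiplicative.ofAdd 1)) fun s hs => by
        rw [weight_mulSingle, if_neg]
        intro h
        have h1 := Finset.card_le_univ s
        rw [Fintype.card_fin] at h1
        have h2 : 0 < s.card := Finset.card_pos.2 ⟨_, h⟩
        have := (hcon s hs h2).1
        omega
      have := congrFun this ⟨0, h0⟩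
      rw [Pi.mulSingle_eq_same] at this
      exact absurd this (by rw [Pi.one_apply]; decide)
    · have h0 : (0 : ℕ) < m := by omega
      have h1 : (1 : ℕ) < m := by omega
      let a (i : Fin m) : Fin m → Multiplicative (ZMod 2) :=
        Pi.mulSingle i (Multiplicative.ofAdd 1)
      have := hfaith (a ⟨0, h0⟩ * a ⟨1, h1⟩) fun s hs => by
        rw [map_mul, weight_mulSingle, weight_mulSingle]
        rcases Finset.eq_empty_or_nonempty s with rfl | hne
        · simp
        · have h2 := (hcon s hs (Finset.card_pos.2 hne)).2
          have h3 : s = Finset.univ := (Finset.card_eq_iff_eq_univ s).1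
            (le_antisymm (Finset.card_le_univ s) (by simpa using h2))
          simp [h3]
      have := congrFun this ⟨0, h0⟩
      simp only [a] at this
      rw [Pi.mul_apply, Pi.mulSingle_eq_same, Pi.mulSingle_eq_of_ne (by simp)] at this
      exact absurd this (by rw [Pi.one_apply]; decide)
  have hsub : Finset.powersetCard s.card Finset.univ ⊆ X := fun t ht => by
    obtain ⟨σ, rfl⟩ := Finset.exists_perm_map_eq (Finset.mem_powersetCard.1 ht).2.symm
    exact hX s hs σ
  have hchoose : (Finset.powersetCard s.card (Finset.univ : Finset (Fin m))).card =
      m.choose s.card := by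
    rw [Finset.card_powersetCard, Finset.card_univ, Fintype.card_fin]
  have hle := Finset.card_le_card hsub
  have hk : s.card = 1 ∨ s.card + 1 = m ∧ 0 < s.card := by
    by_contra! hcon
    have : m < m.choose s.card := Nat.lt_choose_of_one_lt (by omega) (by omega)
    omega
  refine ⟨s.card, Or.inl ⟨hk, (Finset.eq_of_subset_of_card_le hsub ?_).symm⟩⟩
  rw [hchoose]
  rcases hk with hk | hk
  · rw [hk, Nat.choose_one_right]
    exact hcard
  · exact hcard.trans (Nat.le_choose_of_pos_of_lt hk.2 (by omega))

/-! ### Weight spaces -/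

variable {V : Type*} [AddCommGroup V] [DistribMulAction (Hyperoctahedral m) V]

variable (V) in
/-- The elements of `V` on which the base group acts through the character `weight s`. -/
def weightSpace (s : Finset (Fin m)) : AddSubgroup V where
  carrier := {v | ∀ a, (SemidirectProduct.inl a : Hyperoctahedral m) • v = weight s a • v}
  zero_mem' a := by simp
  add_mem' hv hw a := by rw [smul_add, hv a, hw a, smul_add]
  neg_mem' hv a := by rw [smul_neg, hv a, smul_neg]

variable (V) in
/-- The projection to `weightSpace V s`, multiplied by `2 ^ m`. -/
def weightMap (s : Finset (Fin m)) : V →+ V :=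
  ∑ a, weight s a • DistribSMul.toAddMonoidHom V (SemidirectProduct.inl a : Hyperoctahedral m)

theorem weightMap_apply (s : Finset (Fin m)) (v : V) : weightMap V s v =
    ∑ a, weight s a • (SemidirectProduct.inl a : Hyperoctahedral m) • v := by
  simp [weightMap, AddMonoidHom.finsetSum_apply]

theorem weightMap_mem (s : Finset (Fin m)) (v : V) : weightMap V s v ∈ weightSpace V s := by
  intro b
  rw [weightMap_apply, Finset.smul_sum, Finset.smul_sum, ← Equiv.sum_comp (Equiv.mulLeft b)]
  refine Finset.sum_congr rfl fun a _ => ?_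
  rw [smul_comm, smul_smul, ← map_mul, Equiv.coe_mulLeft, ← mul_assoc, mul_self_eq_one, one_mul,
    smul_smul, map_mul]

theorem weightMap_of_mem {s : Finset (Fin m)} {v : V} (hv : v ∈ weightSpace V s) :
    weightMap V s v = 2 ^ m • v := by
  rw [weightMap_apply, Finset.sum_congr rfl fun a _ => by
    rw [hv a, smul_smul, weight_mul_self, one_smul] ]
  simp

theorem sum_weightMap (v : V) : ∑ s : Finset (Fin m), weightMap V s v = 2 ^ m • v := by
  simp only [weightMap_apply]
  rw [Finset.sum_comm, Finset.sum_congr rfl fun a _ => by rw [← Finset.sum_smul, sum_weight],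
    Finset.sum_eq_single 1]
  · rw [if_pos rfl, map_one, one_smul]
    norm_cast
  · intro a _ ha
    rw [if_neg ha, zero_smul]
  · simp

/-- A generator at which `s` and `t` differ acts on `weightMap V s v` with both signs, because
`weightMap` commutes with the base group. -/
theorem weightMap_eq_zero (hinv : ∀ v : V, v + v = 0 → v = 0) {s t : Finset (Fin m)} (hst : s ≠ t)
    {v : V} (hv : v ∈ weightSpace V t) : weightMap V s v = 0 := by
  obtain ⟨i, hi⟩ : ∃ i, ¬ (i ∈ s ↔ i ∈ t) := by
    by_contra! h
    exact hst (Finset.ext h)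
  let a : Fin m → Multiplicative (ZMod 2) := Pi.mulSingle i (Multiplicative.ofAdd 1)
  have h1 := weightMap_mem s v a
  have h2 : (SemidirectProduct.inl a : Hyperoctahedral m) • weightMap V s v =
      weight t a • weightMap V s v := by
    rw [← map_zsmul, ← hv a, weightMap_apply, weightMap_apply, Finset.smul_sum]
    refine Finset.sum_congr rfl fun b _ => ?_
    rw [smul_comm, smul_smul, smul_smul, ← map_mul, ← map_mul, mul_comm]
  rw [h1, weight_mulSingle, weight_mulSingle] at h2
  apply hinv
  by_cases hs : i ∈ s
  · have ht : i ∉ t := fun h => hi (iff_of_true hs h)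
    rw [if_pos hs, if_neg ht, neg_smul, one_smul] at h2
    nth_rw 1 [← h2]
    exact neg_add_cancel _
  · have ht : i ∈ t := by tauto
    rw [if_neg hs, if_pos ht, neg_smul, one_smul] at h2
    nth_rw 1 [h2]
    exact neg_add_cancel _

theorem eq_zero_of_two_pow_nsmul (hinv : ∀ v : V, v + v = 0 → v = 0) (k : ℕ) {v : V}
    (h : 2 ^ k • v = 0) : v = 0 := by
  induction k with
  | zero => simpa using h
  | succ k ih =>
    rw [pow_succ, mul_smul, two_nsmul, smul_add] at h
    exact ih (hinv _ h)

theorem exists_two_pow_nsmul (hdiv : ∀ v : V, ∃ w, w + w = v) (k : ℕ) (v : V) :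
    ∃ w, 2 ^ k • w = v := by
  induction k generalizing v with
  | zero => exact ⟨v, by simp⟩
  | succ k ih =>
    obtain ⟨w, rfl⟩ := ih v
    obtain ⟨u, rfl⟩ := hdiv w
    exact ⟨u, by rw [pow_succ, mul_smul, two_nsmul]⟩

theorem iSupIndep_weightSpace (hinv : ∀ v : V, v + v = 0 → v = 0) :
    iSupIndep (weightSpace V : Finset (Fin m) → AddSubgroup V) := by
  intro s
  rw [AddSubgroup.disjoint_def]
  intro v hv hv'
  have h : ⨆ t, ⨆ (_ : t ≠ s), weightSpace V t ≤ (weightMap V s).ker :=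
    iSup₂_le fun t ht w hw => weightMap_eq_zero hinv ht.symm hw
  have := h hv'
  rw [AddMonoidHom.mem_ker, weightMap_of_mem hv] at this
  exact eq_zero_of_two_pow_nsmul hinv m this

theorem iSup_weightSpace (hdiv : ∀ v : V, ∃ w, w + w = v) :
    ⨆ s : Finset (Fin m), weightSpace V s = ⊤ := by
  refine eq_top_iff.2 fun v _ => ?_
  obtain ⟨w, rfl⟩ := exists_two_pow_nsmul hdiv m v
  rw [← sum_weightMap]
  exact AddSubgroup.sum_mem _ fun s _ => AddSubgroup.mem_iSup_of_mem s (weightMap_mem s w)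

/-- Being an image of `V` makes the weight space inherit connectedness. -/
theorem range_weightMap (hinv : ∀ v : V, v + v = 0 → v = 0) (hdiv : ∀ v : V, ∃ w, w + w = v)
    (s : Finset (Fin m)) : (⊤ : AddSubgroup V).map (weightMap V s) = weightSpace V s := by
  refine le_antisymm ?_ fun v hv => ?_
  · rintro _ ⟨v, -, rfl⟩
    exact weightMap_mem s v
  · obtain ⟨w, rfl⟩ := exists_two_pow_nsmul hdiv m v
    refine ⟨w, trivial, ?_⟩
    rw [← sub_eq_zero]
    apply eq_zero_of_two_pow_nsmul hinv m
    rw [smul_sub, ← map_nsmul, weightMap_of_mem hv, sub_self]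

theorem smul_mem_weightSpace {s : Finset (Fin m)} (σ : Equiv.Perm (Fin m)) {v : V}
    (hv : v ∈ weightSpace V s) :
    (SemidirectProduct.inr σ : Hyperoctahedral m) • v ∈ weightSpace V (s.map σ.toEmbedding) := by
  intro a
  have h : (SemidirectProduct.inl a : Hyperoctahedral m) * SemidirectProduct.inr σ =
      SemidirectProduct.inr σ * SemidirectProduct.inl (permuteCoordinates m σ⁻¹ a) := by
    rw [map_inv, SemidirectProduct.inl_aut_inv]
    simp [mul_assoc]
  rw [smul_smul, h, mul_smul, hv, weight_map, smul_comm]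

theorem eq_one_of_weight_eq_one [FaithfulSMul (Hyperoctahedral m) V]
    (hdiv : ∀ v : V, ∃ w, w + w = v) {a : Fin m → Multiplicative (ZMod 2)}
    (h : ∀ s, weightSpace V s ≠ ⊥ → weight s a = 1) : a = 1 := by
  apply SemidirectProduct.inl_injective (φ := permuteCoordinates m)
  apply FaithfulSMul.eq_of_smul_eq_smul (α := V)
  intro v
  rw [map_one, one_smul]
  have hv : v ∈ ⨆ s : Finset (Fin m), weightSpace V s := by rw [iSup_weightSpace hdiv]; trivial
  induction hv using AddSubgroup.iSup_induction' with
  | hp s w hw =>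
    by_cases hs : weightSpace V s = ⊥
    · rw [hs, AddSubgroup.mem_bot] at hw
      rw [hw, smul_zero]
    · rw [hw, h s hs, one_smul]
  | h1 => rw [smul_zero]
  | hadd x y _ _ hx hy => rw [smul_add, hx, hy]

end Hyperoctahedral

/-! ### Decompositions adapted to a family of involutions -/

theorem DirectSum.isInternal_addSubgroup_of_iSupIndep_of_iSup_eq_top {ι A : Type*}
    [DecidableEq ι] [AddCommGroup A] {U : ι → AddSubgroup A} (hind : iSupIndep U)
    (htop : ⨆ i, U i = ⊤) : DirectSum.IsInternal U := by
  refine ⟨hind.dfinsuppSumAddHom_injective, ?_⟩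
  rw [← AddMonoidHom.range_eq_top, eq_top_iff, ← htop]
  refine iSup_le fun i v hv => ⟨DirectSum.of (fun i => U i) i ⟨v, hv⟩, ?_⟩
  exact DirectSum.coeAddMonoidHom_of U i ⟨v, hv⟩

section Involutions

variable {G V ι : Type*} [Group G] [AddCommGroup V] [DistribMulAction G V] [DecidableEq ι]
  {U : ι → AddSubgroup V} {d : ι → G}
  (hd : ∀ i j, ∀ v ∈ U j, d i • v = if i = j then -v else v)
  (htop : ⨆ i, U i = ⊤)

include hd htop

/-- The map `1 - d i` is twice the projection to `U i`; hence these maps sum to doubling in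
`sum_sub_smul`. -/
theorem sub_smul_mem (i : ι) (v : V) : v - d i • v ∈ U i := by
  have hv : v ∈ ⨆ i, U i := by rw [htop]; trivial
  induction hv using AddSubgroup.iSup_induction' with
  | hp j w hw =>
    rw [hd i j w hw]
    split_ifs with h
    · subst h
      exact (U i).sub_mem hw ((U i).neg_mem hw)
    · rw [sub_self]
      exact (U i).zero_mem
  | h1 => simp
  | hadd x y _ _ hx hy =>
    rw [smul_add, add_sub_add_comm]
    exact (U i).add_mem hx hy

theorem sum_sub_smul [Fintype ι] (v : V) : ∑ i, (v - d i • v) = v + v := by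
  have hv : v ∈ ⨆ i, U i := by rw [htop]; trivial
  induction hv using AddSubgroup.iSup_induction' with
  | hp j w hw =>
    rw [Finset.sum_eq_single j, hd j j w hw, if_pos rfl, sub_neg_eq_add]
    · intro i _ hi
      rw [hd i j w hw, if_neg hi, sub_self]
    · simp
  | h1 => simp
  | hadd x y _ _ hx hy =>
    simp only [smul_add, add_sub_add_comm]
    rw [Finset.sum_add_distrib, hx, hy, add_add_add_comm]

variable (hinv : ∀ v : V, v + v = 0 → v = 0)
include hinv

theorem eq_zero_of_forall_smul_eq [Fintype ι] {v : V} (h : ∀ i, d i • v = v) : v = 0 := by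
  apply hinv
  rw [← sum_sub_smul hd htop]
  exact Finset.sum_eq_zero fun i _ => by rw [h i, sub_self]

variable (hdiv : ∀ v : V, ∃ w, w + w = v)
include hdiv

theorem commutatorWith_eq (i : ι) : commutatorWith (d i) = U i := by
  refine le_antisymm ((AddSubgroup.closure_le _).2 ?_) fun v hv => ?_
  · rintro _ ⟨v, rfl⟩
    show d i • v - v ∈ U i
    rw [← neg_sub]
    exact (U i).neg_mem (sub_smul_mem hd htop i v)
  · obtain ⟨w, rfl⟩ := hdiv v
    refine AddSubgroup.subset_closure ⟨-w, ?_⟩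
    -- The half `w` of `v` is also inverted, as `2 (d i • w + w) = 0`; hence `v` is the commutator
    -- of `d i` with `-w`.
    have h : d i • w = -w := by
      rw [← sub_eq_zero]
      apply hinv
      rw [sub_add_sub_comm, ← smul_add, hd i i _ hv, if_pos rfl]
      abel
    show d i • -w - -w = w + w
    rw [smul_neg, h, sub_neg_eq_add, neg_neg]

theorem smul_eq_iff_mem_iSup_ne [Fintype ι] (i : ι) (v : V) :
    d i • v = v ↔ v ∈ ⨆ j : {j : ι // j ≠ i}, U j := by
  constructor
  · intro h
    obtain ⟨w, rfl⟩ := hdiv v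
    have hw : d i • w = w := by
      rw [← sub_eq_zero]
      apply hinv
      rw [sub_add_sub_comm, ← smul_add, h, sub_self]
    rw [← sum_sub_smul hd htop]
    refine AddSubgroup.sum_mem _ fun j _ => ?_
    by_cases hj : j = i
    · rw [hj, hw, sub_self]
      exact AddSubgroup.zero_mem _
    · exact AddSubgroup.mem_iSup_of_mem (S := fun j : {j : ι // j ≠ i} => U j) ⟨j, hj⟩
        (sub_smul_mem hd htop j w)
  · intro h
    induction h using AddSubgroup.iSup_induction' with
    | hp j w hw => rw [hd i j w hw, if_neg j.2.symm]
    | h1 => rw [smul_zero]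
    | hadd x y _ _ hx hy => rw [smul_add, hx, hy]

end Involutions

theorem map_commutatorWith {G V : Type*} [Group G] [AddCommGroup V] [DistribMulAction G V]
    {g d d' : G} (h : g * d = d' * g) :
    (commutatorWith d : AddSubgroup V).map (DistribSMul.toAddMonoidHom V g) =
      commutatorWith d' := by
  rw [commutatorWith, AddMonoidHom.map_closure, ← Set.range_comp, commutatorWith,
    ← (MulAction.surjective g).range_comp fun v : V => d' • v - v]
  congr 2
  funext v
  simp [smul_sub, smul_smul, h]

/-! ### The involutions `e i` and `e i * eAll m` -/

namespace Hyperoctahedral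

theorem exists_involutions {m : ℕ} {V : Type*} [AddCommGroup V]
    [DistribMulAction (Hyperoctahedral m) V] {X : Finset (Finset (Fin m))}
    (h : X = Finset.univ.image (fun i => {i}) ∨
      Even m ∧ X = Finset.univ.image (fun i => {i}ᶜ)) :
    ∃ (d : Fin m → Hyperoctahedral m) (w : Fin m → Finset (Fin m)),
      ((∀ i, d i = e i) ∨ (∀ i, d i = e i * eAll m)) ∧ w.Injective ∧ X = Finset.univ.image w ∧
      ∀ i j, ∀ v ∈ weightSpace V (w j), d i • v = if i = j then -v else v := by
  rcases h with h | ⟨hm, h⟩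
  · refine ⟨e, _, Or.inl fun _ => rfl, Finset.singleton_injective, h, fun i j v hv => ?_⟩
    rw [e, hv, weight_mulSingle]
    simp only [Finset.mem_singleton]
    split_ifs <;> simp
  · refine ⟨_, _, Or.inr fun _ => rfl, compl_injective.comp Finset.singleton_injective, h,
      fun i j v hv => ?_⟩
    rw [e, eAll, mul_smul, hv, smul_comm, hv, weight_mulSingle, weight_prod_mulSingle,
      Function.comp_apply, Finset.card_compl, Finset.card_singleton, Fintype.card_fin]
    -- On the weight `{j}ᶜ` the product of all generators acts by `(-1) ^ (m - 1) = -1`, which turns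
    -- the sign of `e i` into -1 exactly for `i = j`.
    have hm1 : Odd (m - 1) := by
      obtain ⟨k, rfl⟩ := hm
      have := i.pos
      exact ⟨k - 1, by omega⟩
    rw [hm1.neg_one_pow]
    simp only [Finset.mem_compl, Finset.mem_singleton]
    split_ifs <;> simp

theorem conj_of_eq {m : ℕ} {d : Fin m → Hyperoctahedral m}
    (h : (∀ i, d i = e i) ∨ (∀ i, d i = e i * eAll m)) (g : Hyperoctahedral m) (i : Fin m) :
    g * d i = d (g.right i) * g := by
  rcases h with h | h
  · rw [h, h, conj_e]
  · rw [h, h, ← mul_assoc, conj_e, mul_assoc, conj_eAll, mul_assoc]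

theorem mem_base_of_eq {m : ℕ} {d : Fin m → Hyperoctahedral m}
    (h : (∀ i, d i = e i) ∨ (∀ i, d i = e i * eAll m)) (i : Fin m) : d i ∈ base m := by
  rcases h with h | h
  · exact h i ▸ ⟨_, rfl⟩
  · exact h i ▸ mul_mem ⟨_, rfl⟩ ⟨_, rfl⟩

end Hyperoctahedral

/-! ### The theorem -/

namespace Coordinates.IsInterpretableGroup

open Hyperoctahedral

variable {M : Type uM} {V : Type uV} {L : FirstOrder.Language.{uL, vL}} [L.Structure M]
  {c : Coordinates M V} [AddCommGroup V]
  (hV : c.IsInterpretableGroup L) {m : ℕ} [DistribMulAction (Hyperoctahedral m) V]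
  (hact : c.IsDefinableAction L (Hyperoctahedral m))

include hV hact

theorem weightMap_mem_definableFunctions (s : Finset (Fin m)) :
    (weightMap V s : V → V) ∈ hV.definableFunctions := by
  have h : (weightMap V s : V → V) = ∑ a, weight s a •
      fun v : V => (SemidirectProduct.inl a : Hyperoctahedral m) • v := by
    funext v
    simp [weightMap_apply]
  rw [h]
  exact AddSubgroup.sum_mem _ fun a _ => AddSubgroup.zsmul_mem _ (hact _) _

theorem isConnected_weightSpace (hconn : c.IsConnected L (⊤ : AddSubgroup V))
    (hinv : ∀ v : V, v + v = 0 → v = 0) (hdiv : ∀ v : V, ∃ w, w + w = v) (s : Finset (Fin m)) :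
    c.IsConnected L (weightSpace V s) := by
  rw [← range_weightMap hinv hdiv]
  exact hV.isConnected_map hconn (hV.weightMap_mem_definableFunctions hact s)

end Coordinates.IsInterpretableGroup

open Coordinates Hyperoctahedral in
theorem mainTheorem2 {L : FirstOrder.Language.{uL, vL}} {M : Type uM} [L.Structure M]
    {V : Type uV} [AddCommGroup V] (c : Coordinates M V) (hV : c.IsInterpretableGroup L)
    (m n : ℕ) [DistribMulAction (Hyperoctahedral m) V] [FaithfulSMul (Hyperoctahedral m) V]
    (hact : c.IsDefinableAction L (Hyperoctahedral m))
    (hconn : c.IsConnected L (⊤ : AddSubgroup V))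
    (hrank : c.HasMorleyRank L (Set.univ : Set V) n) (hnm : n ≤ m)
    (hinv : ∀ v : V, v + v = 0 → v = 0) :
    m = n ∧
    (∃ d : Fin m → Hyperoctahedral m,
      ((∀ i, d i = Hyperoctahedral.e i) ∨
        (∀ i, d i = Hyperoctahedral.e i * Hyperoctahedral.eAll m)) ∧
      ∃ U : Fin m → AddSubgroup V, (∀ i, U i = commutatorWith (d i)) ∧
        DirectSum.IsInternal U ∧
        (∀ i, c.IsConnected L (U i) ∧ c.HasMorleyRank L (U i : Set V) 1) ∧
        (∀ i, ∀ u ∈ U i, d i • u = -u) ∧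
        (∀ i j, j ≠ i → ∀ u ∈ U j, d i • u = u) ∧
        (∀ i, ∀ v : V, d i • v = v ↔ v ∈ ⨆ j : {j : Fin m // j ≠ i}, U j) ∧
        (∀ g : Hyperoctahedral m, ∀ i, ∃ j,
          (U i).map (DistribSMul.toAddMonoidHom V g) = U j) ∧
        (∀ i j, ∃ g : Hyperoctahedral m,
          (U i).map (DistribSMul.toAddMonoidHom V g) = U j)) ∧
    (∀ W : AddSubgroup V, c.IsConnected L W →
      (∀ g : Hyperoctahedral m, ∀ w ∈ W, g • w ∈ W) → W = ⊥ ∨ W = ⊤) ∧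
    (∀ v : V, (∀ g ∈ Hyperoctahedral.base m, g • v = v) → v = 0) ∧
    (∀ v : V, (∀ g : Hyperoctahedral m, g • v = v) → v = 0) := by
  classical
  obtain ⟨φ, ε, hφ, hε, N, _, f, hsat, hge, hlt⟩ := hrank
  replace hε : c.DefinesEq ε := hε
  replace hge : c.HasRankGE ε f n (Set.univ : Set V) := ⟨φ, hφ, hge⟩
  replace hlt : ¬ c.HasRankGE ε f (n + 1) (Set.univ : Set V) :=
    fun h => hlt (h.formulaRankGE hφ)
  have hdiv : ∀ v : V, ∃ w, w + w = v := by
    refine hV.surjective_of_injective hε hconn hge hlt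
      (g := AddMonoidHom.id V + AddMonoidHom.id V)
      (hV.definableFunctions.add_mem hV.id_mem hV.id_mem) ?_
    exact (injective_iff_map_eq_zero _).2 hinv
  have hW := hV.isConnected_weightSpace hact hconn hinv hdiv
  have hind := iSupIndep_weightSpace (m := m) hinv
  let X : Finset (Finset (Fin m)) := {s | weightSpace V s ≠ ⊥}
  have hX : ∀ s, s ∈ X ↔ weightSpace V s ≠ ⊥ := fun s => by simp [X]
  have hinf : ∀ s ∈ X, (weightSpace V s : Set V).Infinite := fun s hs =>
    hV.infinite_of_isConnected (hW s) ((hX s).1 hs)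
  have hrank : ∀ s r, c.HasRankGE ε f r (weightSpace V s : Set V) → ∀ F ⊆ X, s ∉ F →
      c.HasRankGE ε f (r + F.card) (Set.univ : Set V) := fun s r hr F hFX hF =>
    hV.hasRankGE_mono hε hconn.1 (Set.subset_univ _)
      (hV.hasRankGE_add_card hε hind (fun s => (hW s).1) hr F hF fun s hs => hinf s (hFX hs)).1
  -- With `n + 1` weights, one of rank 1 and `n` others would give rank `n + 1`.
  have hXn : X.card ≤ n := by
    by_contra! hcon
    obtain ⟨s, hs⟩ : X.Nonempty := Finset.card_pos.1 (by omega)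
    obtain ⟨F, hF, hFn⟩ := Finset.exists_subset_card_eq (s := X.erase s) (n := n)
      (by rw [Finset.card_erase_of_mem hs]; omega)
    apply hlt
    rw [add_comm, ← hFn]
    exact hrank s 1 (hV.hasRankGE_one hε (hW s).1 (hinf s hs)) F
      (hF.trans (Finset.erase_subset _ _)) fun h => Finset.notMem_erase s X (hF h)
  obtain ⟨hXm, hXeq⟩ := eq_image_singleton_or_compl (X := X)
    (fun s hs σ => (hX _).2 fun hbot => (hX s).1 hs <| (AddSubgroup.eq_bot_iff_forall _).2
      fun v hv => by
        have := smul_mem_weightSpace σ hv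
        rwa [hbot, AddSubgroup.mem_bot, smul_eq_zero_iff_eq] at this)
    (hXn.trans hnm) (fun a ha => eq_one_of_weight_eq_one (V := V) hdiv fun s hs =>
      ha s ((hX s).2 hs))
  obtain rfl : m = n := le_antisymm (hXm ▸ hXn) hnm
  -- A rank-two weight space and the `m - 1` others would together give rank `m + 1`.
  have hrank2 : ∀ s ∈ X, ¬ c.HasRankGE ε f 2 (weightSpace V s : Set V) := fun s hs h2 => by
    have hpos : 0 < X.card := Finset.card_pos.2 ⟨s, hs⟩
    have := hrank s 2 h2 (X.erase s) (Finset.erase_subset _ _) (Finset.notMem_erase s X)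
    rw [Finset.card_erase_of_mem hs, hXm] at this
    exact hlt (by convert this using 1; omega)
  obtain ⟨d, w, hde, hw, hXw, hd⟩ := exists_involutions (V := V) hXeq
  have hwX : ∀ i, w i ∈ X := fun i => hXw ▸ Finset.mem_image_of_mem w (Finset.mem_univ i)
  have htop : ⨆ i, weightSpace V (w i) = ⊤ := by
    rw [eq_top_iff, ← iSup_weightSpace (m := m) hdiv]
    refine iSup_le fun s => ?_
    by_cases hs : s ∈ X
    · rw [hXw] at hs
      obtain ⟨i, -, rfl⟩ := Finset.mem_image.1 hs
      exact le_iSup (fun i => weightSpace V (w i)) i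
    · rw [not_not.1 fun h => hs ((hX s).2 h)]
      exact bot_le
  have hcomm := commutatorWith_eq hd htop hinv hdiv
  have hmap : ∀ (g : Hyperoctahedral m) i,
      (weightSpace V (w i)).map (DistribSMul.toAddMonoidHom V g) =
        weightSpace V (w (g.right i)) := fun g i => by
    rw [← hcomm, ← hcomm, map_commutatorWith (conj_of_eq hde g i)]
  have htrans : ∀ i j, ∃ g : Hyperoctahedral m,
      (weightSpace V (w i)).map (DistribSMul.toAddMonoidHom V g) = weightSpace V (w j) :=
    fun i j => ⟨SemidirectProduct.inr (Equiv.swap i j), by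
      rw [hmap, SemidirectProduct.right_inr, Equiv.swap_apply_left]⟩
  have hfix : ∀ v : V, (∀ i, d i • v = v) → v = 0 :=
    fun v => eq_zero_of_forall_smul_eq hd htop hinv
  have hrankU : ∀ i, c.HasMorleyRank L (weightSpace V (w i) : Set V) 1 := fun i => by
    obtain ⟨ψ, hψ⟩ := (hW (w i)).1.exists_defines
    exact ⟨ψ, ε, hψ, hε, N, _, f, hsat,
      (hV.hasRankGE_one hε (hW _).1 (hinf _ (hwX i))).formulaRankGE hψ,
      fun h => hrank2 _ (hwX i) ⟨ψ, hψ, h⟩⟩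
  have hint : DirectSum.IsInternal fun i => weightSpace V (w i) :=
    DirectSum.isInternal_addSubgroup_of_iSupIndep_of_iSup_eq_top (hind.comp hw) htop
  have hcent := smul_eq_iff_mem_iSup_ne hd htop hinv hdiv
  refine ⟨rfl, ⟨d, hde, fun i => weightSpace V (w i), fun i => (hcomm i).symm, hint,
    fun i => ⟨hW _, hrankU i⟩, fun i u hu => (hd i i u hu).trans (if_pos rfl),
    fun i j hij u hu => (hd i j u hu).trans (if_neg hij.symm),
    hcent, fun g i => ⟨_, hmap g i⟩, htrans⟩, ?_,
    fun v hv => hfix v fun i => hv _ (mem_base_of_eq hde i), fun v hv => hfix v fun i => hv _⟩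
  · intro W hWc hWinv
    let g : Fin m → V →+ V := fun i => AddMonoidHom.id V - DistribSMul.toAddMonoidHom V (d i)
    have hg : ∀ i, (g i : V → V) ∈ hV.definableFunctions := fun i =>
      hV.definableFunctions.sub_mem hV.id_mem (hact (d i))
    have hgU : ∀ i, W.map (g i) ≤ weightSpace V (w i) := by
      rintro i _ ⟨v, -, rfl⟩
      exact sub_smul_mem hd htop i v
    have hgW : ∀ i, W.map (g i) ≤ W := by
      rintro i _ ⟨v, hv, rfl⟩
      exact W.sub_mem hv (hWinv _ v hv)
    by_cases hbot : ∀ i, W.map (g i) = ⊥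
    · left
      refine (AddSubgroup.eq_bot_iff_forall _).2 fun v hv => hfix v fun i => ?_
      have : g i v ∈ W.map (g i) := ⟨v, hv, rfl⟩
      rw [hbot i, AddSubgroup.mem_bot] at this
      exact (sub_eq_zero.1 this).symm
    · right
      push Not at hbot
      obtain ⟨i, hi⟩ := hbot
      have hc := hV.isConnected_map hWc (hg i)
      -- The image is infinite, so infinite index in the weight space would force rank 2 there;
      -- connectedness excludes proper finite index.
      have heq := (hW (w i)).2 _ (hgU i) hc.1 fun h0 => hrank2 _ (hwX i) <|
        hV.hasRankGE_succ_of_relIndex_eq_zero hε (hgU i) hc.1 (hW _).1 h0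
          (hV.hasRankGE_one hε hc.1 (hV.infinite_of_isConnected hc hi))
      rw [eq_top_iff, ← htop]
      refine iSup_le fun j => ?_
      obtain ⟨x, hx⟩ := htrans i j
      rw [← hx, ← heq]
      rintro _ ⟨v, hv, rfl⟩
      exact hWinv x v (hgW i hv)
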